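/- Let $\mathcal H$ be a real Hilbert space, $A:\mathcal H\rightrightarrows\mathcal H$ maximally monotone, $\beta>0$, and $B:\mathcal H\to\mathcal H$ $\beta$-cocoercive, i.e. $\langle x-y,Bx-By\rangle\ge\beta\|Bx-By\|^2$ for all $x,y\in\mathcal H$. Assume that $\operatorname{zer}(A+B)=\{x\in\mathcal H: 0\in Ax+Bx\}\neq\emptyset$. Let $\gamma\in(0,2\beta)$, $\delta=\frac{4\beta-\gamma}{2\beta}$, let $\lambda:[0,+\infty)\to[0,\delta]$ be Lebesgue measurable with $$\int_0^{+\infty}\lambda(t)(\delta-\lambda(t))\,dt=+\infty\quad\text{or}\quad \inf_{t\ge0}\lambda(t)>0,$$ and let $x_0\in\mathcal H$. Then the resolvent $J_{\gamma A}=(\mathrm{Id}+\gamma A)^{-1}$ is single-valued and defined on all of $\mathcal H$, and the system $$\dot x(t)=\lambda(t)\left[J_{\gamma A}\big(x(t)-\gamma B(x(t))\big)-x(t)\right],\qquad x(0)=x_0,$$ has a unique strong global solution $x:[0,+\infty)\to\mathcal H$, that is, a function that is absolutely continuous on $[0,b]$ for every $b>0$, satisfies the equation for almost every $t\geq 0$,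 and has $x(0)=x_0$. Moreover: (i) $x$ is bounded and $\int_0^{+\infty}\|\dot x(t)\|^2dt<+\infty$; (ii) $\lim_{t\to+\infty}\left[J_{\gamma A}\big(x(t)-\gamma B(x(t))\big)-x(t)\right]=0$; (iii) $\lim_{t\to+\infty}\dot x(t)=0$, where $t$ runs over the points at which $x$ is differentiable; (iv) $x(t)$ converges weakly to a point in $\operatorname{zer}(A+B)$ as $t\to+\infty$. If $\inf_{t\ge0}\lambda(t)>0$, then also: (v) $\lim_{t\to+\infty}B(x(t))=By$ for every $y\in\operatorname{zer}(A+B)$, and $B$ is constant on $\operatorname{zer}(A+B)$; (vi) if $A$ or $B$ is uniformly monotone, then $\operatorname{zer}(A+B)$ has exactly one point and $x(t)$ converges strongly to it as $t\to+\infty$. Here an operator $C:\mathcal H\rightrightarrows\mathcal H$ is called uniformly monotone if there is an increasing (that is, nondecreasing) function $\phi:[0,+\infty)\to[0,+\infty]$, vanishing only at $0$, with $\langle x-y,u-v\rangle\ge\phi(\|x-y\|)$ whenever $u\in Cx$ and $v\in Cy$. -/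

import Mathlib

open Set Filter Topology MeasureTheory

namespace MonOp

variable {H : Type*} [NormedAddCommGroup H] [InnerProductSpace ℝ H]

/-- The zeros of a set-valued operator `A : H ⇉ H`. -/
def zer (A : H → Set H) : Set H := {x | (0 : H) ∈ A x}

/-- A single-valued mapping, regarded as a set-valued operator. -/
def ofFun (B : H → H) : H → Set H := fun x => {B x}

/-- The (Minkowski) sum of two set-valued operators. -/
def add (A B : H → Set H) : H → Set H := fun x => {w | ∃ u ∈ A x, ∃ v ∈ B x, w = u + v}

/-- The multiple `γ A` of a set-valued operator. -/
def smul (γ : ℝ) (A : H → Set H) : H → Set H := fun x => {w | ∃ u ∈ A x, w = γ • u}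

/-- Monotonicity of a set-valued operator. -/
def IsMonotone (A : H → Set H) : Prop :=
  ∀ x y u v, u ∈ A x → v ∈ A y → 0 ≤ inner ℝ (x - y) (u - v)

/-- Maximal monotonicity: no monotone operator has a strictly larger graph. -/
def IsMaximallyMonotone (A : H → Set H) : Prop :=
  IsMonotone A ∧ ∀ A' : H → Set H, IsMonotone A' → (∀ x, A x ⊆ A' x) → A' = A

/-- Uniform monotonicity, with a modulus `φ : [0, ∞) → [0, ∞]` that is increasing and
vanishes only at `0`. The inequality is one between extended real numbers. -/
def IsUniformlyMonotone (A : H → Set H) : Prop :=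
  ∃ φ : NNReal → ENNReal, Monotone φ ∧ (∀ r, φ r = 0 ↔ r = 0) ∧
    ∀ x y u v, u ∈ A x → v ∈ A y →
      ((φ ‖x - y‖₊ : ENNReal) : EReal) ≤ ((inner ℝ (x - y) (u - v) : ℝ) : EReal)

/-- `β`-cocoercivity of a single-valued mapping. -/
def IsCocoercive (β : ℝ) (B : H → H) : Prop :=
  ∀ x y, β * ‖B x - B y‖ ^ 2 ≤ inner ℝ (x - y) (B x - B y)

/-- The set-valued resolvent `J_A = (Id + A)⁻¹`. -/
def resolventSet (A : H → Set H) (z : H) : Set H := {p | ∃ u ∈ A p, p + u = z}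

/-- The resolvent as a mapping: `resolvent A z` is the element of `J_A z`. (A value without
meaning at the points `z` where `J_A z` is empty; there is none if `A` is maximally monotone.) -/
noncomputable def resolvent (A : H → Set H) (z : H) : H :=
  Classical.epsilon fun p => p ∈ resolventSet A z

/-- Local absolute continuity on `[0, ∞)`. -/
def LocallyAbsolutelyContinuous (x : ℝ → H) : Prop :=
  ∀ b : ℝ, 0 < b → AbsolutelyContinuousOnInterval x 0 b

/-- Strong global solutions on `[0, ∞)` of `x' = lam(t) (T x - x)`, `x 0 = x₀`. The coefficient
`lam` is merely measurable, so the equation is required at almost every time. Values of `x` and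
`lam` at negative times play no role. -/
structure IsStrongGlobalSolution (T : H → H) (lam : ℝ → ℝ) (x₀ : H) (x : ℝ → H) : Prop where
  locallyAC : LocallyAbsolutelyContinuous x
  eqn : ∀ᵐ t ∂(volume.restrict (Ici (0 : ℝ))), HasDerivAt x (lam t • (T (x t) - x t)) t
  init : x 0 = x₀

/-- The forward-backward mapping `J_{γA} ∘ (Id - γB)`. -/
noncomputable def forwardBackward (γ : ℝ) (A : H → Set H) (B : H → H) (z : H) : H :=
  resolvent (smul γ A) (z - γ • B z)

end MonOp

/-!
The forward-backward mapping `T = J_{γA} ∘ (Id - γB)` is nonexpansive for `γ ≤ 2β`, and its fixed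
points are the zeros of `A + B`. Existence, uniqueness, the estimates and the weak convergence hold
for the system of any nonexpansive `T` with a fixed point and any bounded measurable `lam ≥ 0` that
is not integrable on the half-line, which both alternatives in the hypothesis on `lam` ensure
(`not_integrableOn_of_lintegral_mul_eq_top`).

*The resolvent.* Minty's theorem comes from the Debrunner–Flor lemma
(`MonOp.IsMonotone.exists_forall_inner_nonneg`). Each point of the graph cuts out a closed ball;
finitely many of these balls meet, by maximising a concave quadratic over a simplex, and weak
compactness gives a point common to all.

*Reduction to an autonomous system.* Put `Λ t = ∫₀ᵗ lam` and let `y' = T y - y`, `y 0 = x₀`, which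
has a global solution since the field is Lipschitz (`LipschitzWith.exists_forall_hasDerivAt`).
Then `y ∘ Λ` is a strong solution of the system, and it is the only one, because the squared
distance of two solutions is absolutely continuous and nonincreasing
(`MonOp.IsStrongGlobalSolution.eqOn`). As `Λ` is Lipschitz and tends to infinity, asymptotics of
`y` carry over to `x`, also to `deriv x` at the exceptional times, where a Lipschitz bound is used
in place of the equation.

*Asymptotics of `y`.* For a fixed point `z`, `(‖y - z‖²)' ≤ -‖y'‖²`, and `‖y'‖` is nonincreasing, so
`t ‖y' t‖² ≤ ‖x₀ - z‖²` and `y' → 0`. Demiclosedness of `Id - T` and Opial's lemma give weak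
convergence of `y` to a fixed point. The first inequality, read for `x`, bounds `∫ ‖x'‖²`.

*The operators.* Monotonicity of `A` at the pair `T x`, `z` and cocoercivity of `B` at `x`, `z`
bound `β ‖B x - B z‖²` by a multiple of `‖T x - x‖`, so that `B (x t) → B z`; if one of the
operators is uniformly monotone, the same inequalities force `x t → z`.
-/

/-! ### Weak limits along ultrafilters -/

section WeakLimits

variable {H : Type*} [NormedAddCommGroup H] [InnerProductSpace ℝ H]

/-- Banach–Alaoglu and the Riesz representation: bounded families converge weakly along
ultrafilters. -/
theorem Ultrafilter.exists_tendsto_inner [CompleteSpace H] {ι : Type*} (U : Ultrafilter ι)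
    (x : ι → H) (C : ℝ) (h : ∀ᶠ i in (U : Filter ι), ‖x i‖ ≤ C) :
    ∃ p : H, ∀ v, Tendsto (fun i => inner ℝ (x i) v) U (𝓝 (inner ℝ p v)) := by
  let f : ι → WeakDual ℝ H := fun i => StrongDual.toWeakDual (InnerProductSpace.toDual ℝ H (x i))
  have hK := WeakDual.isCompact_closedBall (𝕜 := ℝ) (0 : StrongDual ℝ H) C
  have hmem : ∀ᶠ i in (U : Filter ι),
      f i ∈ WeakDual.toStrongDual ⁻¹' Metric.closedBall (0 : StrongDual ℝ H) C := by
    filter_upwards [h] with i hi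
    simpa [f] using hi
  obtain ⟨g, -, hg⟩ := hK.ultrafilter_le_nhds' (U.map f) hmem
  refine ⟨(InnerProductSpace.toDual ℝ H).symm (WeakDual.toStrongDual g), fun v => ?_⟩
  have h1 : Tendsto (fun i => f i v) U (𝓝 (g v)) :=
    ((WeakDual.eval_continuous v).tendsto g).comp hg
  simpa [f] using h1

theorem tendsto_toWeakSpace_of_tendsto_inner [CompleteSpace H] {ι : Type*} {l : Filter ι}
    {x : ι → H} {p : H} (h : ∀ v, Tendsto (fun i => inner ℝ (x i) v) l (𝓝 (inner ℝ p v))) :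
    Tendsto (fun i => toWeakSpace ℝ H (x i)) l (𝓝 (toWeakSpace ℝ H p)) := by
  have hinj : Function.Injective (topDualPairing ℝ H).flip := by
    intro a b hab
    refine ext_inner_left ℝ fun v => ?_
    have := DFunLike.congr_fun hab (InnerProductSpace.toDual ℝ H v)
    simpa using this
  refine (WeakBilin.tendsto_iff_forall_eval_tendsto _ hinj).2 fun φ => ?_
  have e : ∀ z : H, inner ℝ z ((InnerProductSpace.toDual ℝ H).symm φ) = φ z := fun z => by
    rw [real_inner_comm, InnerProductSpace.toDual_symm_apply]
  have := h ((InnerProductSpace.toDual ℝ H).symm φ)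
  simp only [e] at this
  exact this

/-- The balls `{p | ‖p‖ ^ 2 + ⟪p, v⟫ ≤ c}` are weakly closed. -/
theorem norm_sq_add_inner_le_of_tendsto_inner {ι : Type*} {l : Filter ι} [l.NeBot]
    {x : ι → H} {p v : H} {c : ℝ} (h : ∀ w, Tendsto (fun i => inner ℝ (x i) w) l (𝓝 (inner ℝ p w)))
    (hc : ∀ᶠ i in l, ‖x i‖ ^ 2 + inner ℝ (x i) v ≤ c) : ‖p‖ ^ 2 + inner ℝ p v ≤ c := by
  have h1 : Tendsto (fun i => 2 * inner ℝ (x i) p - ‖p‖ ^ 2 + inner ℝ (x i) v) l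
      (𝓝 (2 * inner ℝ p p - ‖p‖ ^ 2 + inner ℝ p v)) :=
    (((h p).const_mul 2).sub_const _).add (h v)
  have h2 := le_of_tendsto h1 (b := c) <| by
    filter_upwards [hc] with i hi
    have := sq_nonneg ‖x i - p‖
    rw [norm_sub_sq_real] at this
    linarith
  rw [real_inner_self_eq_norm_sq] at h2
  linarith

end WeakLimits

/-! ### Minty's theorem and the resolvent -/

namespace MonOp

section Minty

variable {H : Type*} [NormedAddCommGroup H] [InnerProductSpace ℝ H]

/-- The finite case of the Debrunner–Flor lemma. The point is `x = ½ ∑ μ i • (y i - v i)`, where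
`μ` maximises over the simplex the concave quadratic
`μ ↦ -¼ ‖∑ μ i • (y i - v i)‖² - ∑ μ i ⟪y i, v i⟫`: the maximum is nonpositive by monotonicity, and
the first-order conditions at `μ` towards the vertices are the inequalities wanted. -/
theorem exists_forall_inner_nonneg_of_fintype {ι : Type*} [Fintype ι] [Nonempty ι] (y v : ι → H)
    (hmon : ∀ i j, 0 ≤ inner ℝ (y i - y j) (v i - v j)) :
    ∃ x : H, ∀ i, 0 ≤ inner ℝ (y i - x) (v i + x) := by
  classical
  let q : (ι → ℝ) → H := fun μ => ∑ i, μ i • (y i - v i)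
  let g : (ι → ℝ) → ℝ := fun μ => -(1 / 4) * ‖q μ‖ ^ 2 - ∑ i, μ i * inner ℝ (y i) (v i)
  have hq : Continuous q := by fun_prop
  have hg : Continuous g := by fun_prop
  obtain ⟨μ, hμ, hmax⟩ := (isCompact_stdSimplex ℝ ι).exists_isMaxOn
    ⟨_, single_mem_stdSimplex ℝ (Classical.arbitrary ι)⟩ hg.continuousOn
  have hμ1 : ∑ i, μ i = 1 := hμ.2
  have hg0 : g μ ≤ 0 := by
    have e1 : q μ = (∑ i, μ i • y i) - ∑ i, μ i • v i := by
      simp [q, smul_sub, Finset.sum_sub_distrib]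
    have e2 : ∑ i, ∑ j, μ i * μ j * inner ℝ (y i - y j) (v i - v j) =
        2 * ∑ i, μ i * inner ℝ (y i) (v i)
          - 2 * inner ℝ (∑ i, μ i • y i) (∑ i, μ i • v i) := by
      have s1 : ∑ i, ∑ j, μ i * μ j * inner ℝ (y i) (v i) = ∑ i, μ i * inner ℝ (y i) (v i) := by
        refine Finset.sum_congr rfl fun i _ => ?_
        rw [← Finset.sum_mul, ← Finset.mul_sum, hμ1, mul_one]
      have s2 : ∑ i, ∑ j, μ i * μ j * inner ℝ (y j) (v j) = ∑ i, μ i * inner ℝ (y i) (v i) := by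
        rw [Finset.sum_comm, ← s1]
        simp only [mul_comm]
      have s3 : ∑ i, ∑ j, μ i * μ j * inner ℝ (y i) (v j) =
          inner ℝ (∑ i, μ i • y i) (∑ i, μ i • v i) := by
        simp only [sum_inner, inner_sum, real_inner_smul_left, real_inner_smul_right]
        rw [Finset.sum_comm]
        refine Finset.sum_congr rfl fun i _ => Finset.sum_congr rfl fun j _ => ?_
        ring
      have s4 : ∑ i, ∑ j, μ i * μ j * inner ℝ (y j) (v i) =
          inner ℝ (∑ i, μ i • y i) (∑ i, μ i • v i) := by
        rw [Finset.sum_comm, ← s3]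
        simp only [mul_comm]
      simp only [inner_sub_left, inner_sub_right, mul_sub, Finset.sum_sub_distrib, s1, s2, s3, s4]
      ring
    have e3 : 0 ≤ ∑ i, ∑ j, μ i * μ j * inner ℝ (y i - y j) (v i - v j) :=
      Finset.sum_nonneg fun i _ => Finset.sum_nonneg fun j _ =>
        mul_nonneg (mul_nonneg (hμ.1 i) (hμ.1 j)) (hmon i j)
    have e4 := sq_nonneg ‖(∑ i, μ i • y i) + ∑ i, μ i • v i‖
    rw [norm_add_sq_real] at e4
    simp only [g, e1]
    rw [norm_sub_sq_real]
    linarith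
  refine ⟨(1 / 2 : ℝ) • q μ, fun i => ?_⟩
  set d : H := (y i - v i) - q μ with hd
  set c : ℝ := inner ℝ (y i) (v i) - ∑ j, μ j * inner ℝ (y j) (v j) with hc
  have hstep : ∀ t ∈ Ioo (0 : ℝ) 1, -(1 / 2) * inner ℝ (q μ) d - c ≤ t * (1 / 4 * ‖d‖ ^ 2) := by
    intro t ht
    let ν : ι → ℝ := (1 - t) • μ + t • Pi.single i (1 : ℝ)
    have hmem : ν ∈ stdSimplex ℝ ι :=
      convex_stdSimplex ℝ ι hμ (single_mem_stdSimplex ℝ i) (by linarith [ht.2]) ht.1.le (by ring)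
    have hq' : q ν = q μ + t • d := by
      have : q ν = (1 - t) • q μ + t • q (Pi.single i (1 : ℝ)) := by
        simp only [q, ν, Pi.add_apply, Pi.smul_apply, smul_eq_mul, add_smul, mul_smul,
          Finset.sum_add_distrib, Finset.smul_sum]
      have hs : q (Pi.single i (1 : ℝ)) = y i - v i := by
        simp [q]
      rw [this, hs, hd]
      module
    have hsum : ∑ j, ν j * inner ℝ (y j) (v j) = ∑ j, μ j * inner ℝ (y j) (v j) + t * c := by
      have : ∑ j, ν j * inner ℝ (y j) (v j) =
          (1 - t) * ∑ j, μ j * inner ℝ (y j) (v j) + t * inner ℝ (y i) (v i) := by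
        simp [ν, add_mul, Finset.sum_add_distrib, Finset.mul_sum, mul_assoc, Pi.single_apply]
      rw [this, hc]
      ring
    have hle : g ν ≤ g μ := hmax hmem
    simp only [g, hq', hsum] at hle
    rw [norm_add_sq_real, real_inner_smul_right, norm_smul, mul_pow, Real.norm_eq_abs, sq_abs]
      at hle
    have : t * (-(1 / 2) * inner ℝ (q μ) d - c) ≤ t * (t * (1 / 4 * ‖d‖ ^ 2)) := by linarith
    exact le_of_mul_le_mul_left this ht.1
  have hlim : -(1 / 2) * inner ℝ (q μ) d - c ≤ 0 := by
    have h1 : Tendsto (fun t : ℝ => t * (1 / 4 * ‖d‖ ^ 2)) (𝓝[>] 0) (𝓝 (0 * (1 / 4 * ‖d‖ ^ 2))) :=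
      (tendsto_id.mul_const _).mono_left nhdsWithin_le_nhds
    rw [zero_mul] at h1
    refine ge_of_tendsto h1 ?_
    filter_upwards [Ioo_mem_nhdsGT (zero_lt_one' ℝ)] with t ht using hstep t ht
  have hgμ : -(1 / 4) * ‖q μ‖ ^ 2 - ∑ j, μ j * inner ℝ (y j) (v j) ≤ 0 := hg0
  have e5 : inner ℝ (q μ) d = inner ℝ (q μ) (y i) - inner ℝ (q μ) (v i) - ‖q μ‖ ^ 2 := by
    rw [hd, inner_sub_right, inner_sub_right, real_inner_self_eq_norm_sq]
  rw [inner_add_right, inner_sub_left, inner_sub_left, real_inner_smul_left,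
    real_inner_smul_right, real_inner_smul_left, real_inner_smul_right,
    real_inner_self_eq_norm_sq, real_inner_comm (q μ) (y i)]
  rw [e5] at hlim
  linarith

/-- The Debrunner–Flor lemma: the ball conditions cut out by the points of the graph have the
finite intersection property, and closed balls are weakly compact. -/
theorem IsMonotone.exists_forall_inner_nonneg [CompleteSpace H] {A : H → Set H}
    (hA : IsMonotone A) : ∃ x : H, ∀ y, ∀ v ∈ A y, 0 ≤ inner ℝ (y - x) (v + x) := by
  classical
  let G := {p : H × H // p.2 ∈ A p.1}
  rcases isEmpty_or_nonempty G with hG | ⟨⟨g₀⟩⟩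
  · exact ⟨0, fun y v hv => (hG.false ⟨(y, v), hv⟩).elim⟩
  have hfin : ∀ s : Finset G, ∃ x : H, ∀ p ∈ s, 0 ≤ inner ℝ (p.1.1 - x) (p.1.2 + x) := by
    intro s
    rcases s.eq_empty_or_nonempty with rfl | hs
    · exact ⟨0, by simp⟩
    · have : Nonempty s := hs.to_subtype
      obtain ⟨x, hx⟩ := exists_forall_inner_nonneg_of_fintype (fun p : s => p.1.1.1)
        (fun p : s => p.1.1.2) (fun i j => hA _ _ _ _ i.1.2 j.1.2)
      exact ⟨x, fun p hp => hx ⟨p, hp⟩⟩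
  choose x hx using hfin
  have hexp : ∀ (p : G) (z : H), 0 ≤ inner ℝ (p.1.1 - z) (p.1.2 + z) ↔
      ‖z‖ ^ 2 + inner ℝ z (p.1.2 - p.1.1) ≤ inner ℝ p.1.1 p.1.2 := by
    intro p z
    rw [inner_add_right, inner_sub_left, inner_sub_left, inner_sub_right,
      real_inner_self_eq_norm_sq, real_inner_comm z p.1.1]
    constructor <;> intro h <;> linarith
  have hev : ∀ p : G, ∀ᶠ s in atTop,
      ‖x s‖ ^ 2 + inner ℝ (x s) (p.1.2 - p.1.1) ≤ inner ℝ p.1.1 p.1.2 := by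
    intro p
    filter_upwards [eventually_ge_atTop {p}] with s hs
    exact (hexp p _).1 (hx s p (hs (Finset.mem_singleton_self p)))
  let U : Ultrafilter (Finset G) := Ultrafilter.of atTop
  have hU : (U : Filter (Finset G)) ≤ atTop := Ultrafilter.of_le _
  have hbdd : ∀ᶠ s in (U : Filter (Finset G)),
      ‖x s‖ ≤ 1 + ‖g₀.1.2 - g₀.1.1‖ + |inner ℝ g₀.1.1 g₀.1.2| := by
    filter_upwards [hU (hev g₀)] with s hs
    have h1 := neg_le_of_abs_le (abs_real_inner_le_norm (x s) (g₀.1.2 - g₀.1.1))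
    have h2 := le_abs_self (inner ℝ g₀.1.1 g₀.1.2)
    have h3 := abs_nonneg (inner ℝ g₀.1.1 g₀.1.2)
    by_contra! hlt
    have h4 := norm_nonneg (g₀.1.2 - g₀.1.1)
    nlinarith [norm_nonneg (x s)]
  obtain ⟨p, hp⟩ := U.exists_tendsto_inner x _ hbdd
  refine ⟨p, fun y v hv => ?_⟩
  exact (hexp ⟨(y, v), hv⟩ p).2 (norm_sq_add_inner_le_of_tendsto_inner hp (hU (hev ⟨(y, v), hv⟩)))

theorem IsMaximallyMonotone.mem_of_forall_inner_nonneg {A : H → Set H}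
    (hA : IsMaximallyMonotone A) {x w : H}
    (h : ∀ y, ∀ u ∈ A y, 0 ≤ inner ℝ (x - y) (w - u)) : w ∈ A x := by
  have hmon : IsMonotone fun z => {u | u ∈ A z ∨ (z = x ∧ u = w)} := by
    rintro a b u v (hu | ⟨rfl, rfl⟩) (hv | ⟨rfl, rfl⟩)
    · exact hA.1 _ _ _ _ hu hv
    · have := h _ _ hu
      rwa [← neg_sub a, ← neg_sub u, inner_neg_neg] at this
    · exact h _ _ hv
    · simp
  have := hA.2 _ hmon fun z u hu => Or.inl hu
  rw [← this]
  exact Or.inr ⟨rfl, rfl⟩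

theorem IsMonotone.smul {A : H → Set H} (hA : IsMonotone A) {γ : ℝ} (hγ : 0 ≤ γ) :
    IsMonotone (smul γ A) := by
  rintro x y _ _ ⟨u, hu, rfl⟩ ⟨v, hv, rfl⟩
  rw [← smul_sub, real_inner_smul_right]
  exact mul_nonneg hγ (hA _ _ _ _ hu hv)

theorem IsMonotone.resolventSet_subsingleton {A : H → Set H} (hA : IsMonotone A) (z : H) :
    (resolventSet A z).Subsingleton := by
  rintro p ⟨u, hu, hpu⟩ q ⟨v, hv, hqv⟩
  have h := hA _ _ _ _ hu hv
  have h1 : u - v = -(p - q) := by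
    rw [eq_sub_of_add_eq' hpu, eq_sub_of_add_eq' hqv]
    abel
  rw [h1, inner_neg_right, real_inner_self_eq_norm_sq] at h
  exact sub_eq_zero.1 (norm_eq_zero.1 (pow_eq_zero_iff two_ne_zero |>.1
    (le_antisymm (by linarith) (sq_nonneg ‖p - q‖))))

/-- Minty's theorem: `Id + γ A` is onto. -/
theorem IsMaximallyMonotone.resolventSet_nonempty [CompleteSpace H] {A : H → Set H}
    (hA : IsMaximallyMonotone A) {γ : ℝ} (hγ : 0 < γ) (z : H) :
    (resolventSet (smul γ A) z).Nonempty := by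
  -- the translate `y ↦ γ A y - z` reduces the claim to the Debrunner–Flor lemma
  have hmon : IsMonotone fun y => {w | w + z ∈ smul γ A y} := by
    intro x y u v hu hv
    have := hA.1.smul hγ.le _ _ _ _ hu hv
    rwa [add_sub_add_right_eq_sub] at this
  obtain ⟨p, hp⟩ := hmon.exists_forall_inner_nonneg
  refine ⟨p, γ • (γ⁻¹ • (z - p)), ⟨_, hA.mem_of_forall_inner_nonneg fun y u hu => ?_, rfl⟩, ?_⟩
  · have h := hp y (γ • u - z) ⟨u, hu, by abel⟩
    have e : γ⁻¹ • (z - p) - u = -(γ⁻¹ • (γ • u - z + p)) := by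
      have : γ⁻¹ • γ • u = u := inv_smul_smul₀ hγ.ne' u
      rw [smul_add, smul_sub, smul_sub, this]
      abel
    rw [e, ← neg_sub y p, inner_neg_neg, real_inner_smul_right]
    exact mul_nonneg (inv_nonneg.2 hγ.le) h
  · rw [smul_smul, mul_inv_cancel₀ hγ.ne', one_smul]
    abel

theorem IsMaximallyMonotone.resolvent_mem [CompleteSpace H] {A : H → Set H}
    (hA : IsMaximallyMonotone A) {γ : ℝ} (hγ : 0 < γ) (z : H) :
    resolvent (smul γ A) z ∈ resolventSet (smul γ A) z :=
  Classical.epsilon_spec (hA.resolventSet_nonempty hγ z)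

theorem IsMaximallyMonotone.resolventSet_eq_singleton [CompleteSpace H] {A : H → Set H}
    (hA : IsMaximallyMonotone A) {γ : ℝ} (hγ : 0 < γ) (z : H) :
    resolventSet (smul γ A) z = {resolvent (smul γ A) z} :=
  (hA.1.smul hγ.le).resolventSet_subsingleton z |>.eq_singleton_of_mem (hA.resolvent_mem hγ z)

end Minty

end MonOp

/-! ### Nonexpansive maps: demiclosedness and Opial's lemma -/

section Opial

variable {H : Type*} [NormedAddCommGroup H] [InnerProductSpace ℝ H]

/-- Opial's lemma, for an arbitrary filter. Convergence of `‖x - p‖` and `‖x - q‖` forces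
convergence of `⟪x, p - q⟫`, so any two weak cluster points `p`, `q` in `F` agree. -/
theorem exists_tendsto_inner_of_forall_tendsto_norm_sub [CompleteSpace H] {ι : Type*}
    {l : Filter ι} [l.NeBot] {x : ι → H} {F : Set H} (hF : F.Nonempty)
    (hnorm : ∀ z ∈ F, ∃ L, Tendsto (fun i => ‖x i - z‖) l (𝓝 L))
    (hcluster : ∀ (U : Ultrafilter ι) (p : H), ↑U ≤ l →
      (∀ v, Tendsto (fun i => inner ℝ (x i) v) U (𝓝 (inner ℝ p v))) → p ∈ F) :
    ∃ p ∈ F, ∀ v, Tendsto (fun i => inner ℝ (x i) v) l (𝓝 (inner ℝ p v)) := by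
  obtain ⟨z, hz⟩ := hF
  obtain ⟨L, hL⟩ := hnorm z hz
  have hbdd : ∀ᶠ i in l, ‖x i‖ ≤ L + 1 + ‖z‖ := by
    filter_upwards [hL.eventually_le_const (lt_add_one L)] with i hi
    have := norm_add_le (x i - z) z
    rw [sub_add_cancel] at this
    linarith
  have hex : ∀ U : Ultrafilter ι, ↑U ≤ l →
      ∃ p ∈ F, ∀ v, Tendsto (fun i => inner ℝ (x i) v) U (𝓝 (inner ℝ p v)) := fun U hU => by
    obtain ⟨p, hp⟩ := U.exists_tendsto_inner x _ (hU hbdd)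
    exact ⟨p, hcluster U p hU hp, hp⟩
  obtain ⟨p, hpF, hp⟩ := hex (Ultrafilter.of l) (Ultrafilter.of_le l)
  refine ⟨p, hpF, fun v => (tendsto_iff_ultrafilter _ _ _).2 fun V hV => ?_⟩
  obtain ⟨q, hqF, hq⟩ := hex V hV
  suffices q = p by
    rw [← this]
    exact hq v
  obtain ⟨a, ha⟩ := hnorm p hpF
  obtain ⟨b, hb⟩ := hnorm q hqF
  have hlim : Tendsto (fun i => inner ℝ (x i) (q - p)) l
      (𝓝 (1 / 2 * (a ^ 2 - b ^ 2 - ‖p‖ ^ 2 + ‖q‖ ^ 2))) := by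
    refine (((((ha.pow 2).sub (hb.pow 2)).sub_const _).add_const _).const_mul _).congr fun i => ?_
    rw [norm_sub_sq_real, norm_sub_sq_real, inner_sub_right]
    ring
  have h1 := tendsto_nhds_unique (hp (q - p)) (hlim.mono_left (Ultrafilter.of_le l))
  have h2 := tendsto_nhds_unique (hq (q - p)) (hlim.mono_left hV)
  rw [← sub_eq_zero, ← inner_self_eq_zero (𝕜 := ℝ), inner_sub_left, h1, h2, sub_self]

/-- Demiclosedness of `Id - T` at `0`, for a nonexpansive map `T`. -/
theorem LipschitzWith.eq_of_tendsto_inner_of_tendsto_sub {T : H → H} (hT : LipschitzWith 1 T)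
    {ι : Type*} {l : Filter ι} [l.NeBot] {x : ι → H} {p : H} {C : ℝ}
    (hbdd : ∀ᶠ i in l, ‖x i‖ ≤ C)
    (hx : ∀ v, Tendsto (fun i => inner ℝ (x i) v) l (𝓝 (inner ℝ p v)))
    (hTx : Tendsto (fun i => T (x i) - x i) l (𝓝 0)) : T p = p := by
  have hl : Tendsto (fun i => 2 * (inner ℝ (x i) (p - T p) - inner ℝ p (p - T p))
      + ‖p - T p‖ ^ 2) l (𝓝 (‖p - T p‖ ^ 2)) := by
    simpa using (((hx (p - T p)).sub_const (inner ℝ p (p - T p))).const_mul 2).add_const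
      (‖p - T p‖ ^ 2)
  have hr : Tendsto (fun i => ‖T (x i) - x i‖ * (2 * (C + ‖p‖) + ‖T (x i) - x i‖)) l (𝓝 0) := by
    have := hTx.norm.mul (hTx.norm.const_add (2 * (C + ‖p‖)))
    simpa using this
  have h := le_of_tendsto_of_tendsto hl hr <| by
    filter_upwards [hbdd] with i hi
    have h1 : ‖x i - T p‖ ≤ ‖T (x i) - x i‖ + ‖x i - p‖ := by
      have h3 : ‖T (x i) - T p‖ ≤ ‖x i - p‖ := by simpa using hT.norm_sub_le (x i) p
      have h4 := norm_sub_le_norm_sub_add_norm_sub (x i) (T (x i)) (T p)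
      rw [norm_sub_rev (x i) (T (x i))] at h4
      linarith
    have h2 : ‖x i - p‖ ≤ C + ‖p‖ := (_root_.norm_sub_le _ _).trans (by linarith)
    have h5 : ‖x i - T p‖ ^ 2 = ‖x i - p‖ ^ 2 + 2 * inner ℝ (x i - p) (p - T p)
        + ‖p - T p‖ ^ 2 := by
      rw [← norm_add_sq_real, sub_add_sub_cancel]
    have h6 : ‖x i - T p‖ ^ 2 ≤ (‖T (x i) - x i‖ + ‖x i - p‖) ^ 2 :=
      pow_le_pow_left₀ (norm_nonneg _) h1 2
    rw [inner_sub_left] at h5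
    nlinarith [norm_nonneg (T (x i) - x i)]
  have h0 : ‖p - T p‖ = 0 := pow_eq_zero_iff two_ne_zero |>.1 (le_antisymm h (sq_nonneg _))
  exact (sub_eq_zero.1 (norm_eq_zero.1 h0)).symm

theorem LipschitzWith.inner_sub_nonpos {T : H → H} (hT : LipschitzWith 1 T) (a b : H) :
    inner ℝ (a - b) ((T a - a) - (T b - b)) ≤ 0 := by
  have h1 : ‖T a - T b‖ ≤ ‖a - b‖ := by simpa using hT.norm_sub_le a b
  have h2 := real_inner_le_norm (a - b) (T a - T b)
  have h3 : (T a - a) - (T b - b) = (T a - T b) - (a - b) := by abel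
  rw [h3, inner_sub_right, real_inner_self_eq_norm_sq]
  nlinarith [norm_nonneg (a - b)]

/-- The displacement of a nonexpansive map points towards its fixed points. -/
theorem LipschitzWith.two_mul_inner_sub_le {T : H → H} (hT : LipschitzWith 1 T) {z : H}
    (hz : T z = z) (a : H) : 2 * inner ℝ (a - z) (T a - a) ≤ -‖T a - a‖ ^ 2 := by
  have h1 : ‖T a - z‖ ≤ ‖a - z‖ := by simpa [hz] using hT.norm_sub_le a z
  have h2 : ‖T a - z‖ ^ 2 = ‖a - z‖ ^ 2 + 2 * inner ℝ (a - z) (T a - a) + ‖T a - a‖ ^ 2 := by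
    rw [← norm_add_sq_real]
    congr 2
    abel
  have h3 := pow_le_pow_left₀ (norm_nonneg _) h1 2
  linarith

end Opial

/-! ### The autonomous flow of a Lipschitz field -/

section GlobalFlow

variable {E : Type*} [NormedAddCommGroup E] [NormedSpace ℝ E]

theorem norm_integral_le_of_norm_le_mul_exp {g : ℝ → E} {C k τ : ℝ} (hk : 0 < k) (hC : 0 ≤ C)
    (hτ : 0 ≤ τ) (hg : ∀ s, 0 ≤ s → ‖g s‖ ≤ C * Real.exp (k * s)) :
    ‖∫ s in (0 : ℝ)..τ, g s‖ ≤ C / k * Real.exp (k * τ) := by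
  have hint : IntervalIntegrable (fun s => C * Real.exp (k * s)) volume 0 τ :=
    Continuous.intervalIntegrable (by fun_prop) _ _
  have h1 := intervalIntegral.norm_integral_le_of_norm_le hτ
    (Eventually.of_forall fun s hs => hg s hs.1.le) hint
  have h2 : ∫ s in (0 : ℝ)..τ, C * Real.exp (k * s) = C / k * (Real.exp (k * τ) - 1) := by
    rw [intervalIntegral.integral_const_mul,
      intervalIntegral.integral_comp_mul_left (fun s => Real.exp s) hk.ne', integral_exp,
      mul_zero, Real.exp_zero, smul_eq_mul]
    ring
  rw [h2] at h1
  have h3 : 0 ≤ C / k := by positivity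
  linarith

/-- Picard–Lindelöf on the whole half-line for a globally Lipschitz field. The solution is
`s ↦ exp (k s) • w s`, where `w` is the fixed point of the Picard operator on bounded continuous
functions, which is a contraction once `k` exceeds the Lipschitz constant. -/
theorem LipschitzWith.exists_forall_hasDerivAt [CompleteSpace E] {f : E → E} {K : NNReal}
    (hf : LipschitzWith K f) (x₀ : E) :
    ∃ y : ℝ → E, y 0 = x₀ ∧ ∀ t, 0 ≤ t → HasDerivAt y (f (y t)) t := by
  let k : ℝ := K + 1
  have hk : 0 < k := by positivity
  -- Functions on the half-line are extended to `ℝ` by their value at `max s 0`.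
  let φ : BoundedContinuousFunction ℝ E → ℝ → E := fun w s => f (Real.exp (k * max s 0) • w s)
  have hφ : ∀ w, Continuous (φ w) := fun w => by
    have := hf.continuous
    have := w.continuous
    fun_prop
  let u : BoundedContinuousFunction ℝ E → ℝ → E := fun w t => x₀ + ∫ s in (0 : ℝ)..t, φ w s
  have hu : ∀ w t, HasDerivAt (u w) (φ w t) t := fun w t =>
    ((hφ w).integral_hasStrictDerivAt 0 t).hasDerivAt.const_add x₀
  have hΦc : ∀ w, Continuous fun t => Real.exp (-(k * max t 0)) • u w (max t 0) := fun w => by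
    have : Continuous (u w) := continuous_iff_continuousAt.2 fun t => (hu w t).continuousAt
    fun_prop
  have hΦb : ∀ w t, ‖Real.exp (-(k * max t 0)) • u w (max t 0)‖ ≤
      ‖x₀‖ + (‖f 0‖ + K * ‖w‖) / k := fun w t => by
    have h0 : 0 ≤ max t 0 := le_max_right _ _
    have h1 := norm_integral_le_of_norm_le_mul_exp (g := φ w) (C := ‖f 0‖ + K * ‖w‖) hk
      (by positivity) h0 fun s hs => by
        have h2 : ‖φ w s - f 0‖ ≤ K * (Real.exp (k * s) * ‖w s‖) := by
          have := hf.norm_sub_le (Real.exp (k * max s 0) • w s) 0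
          rw [sub_zero, norm_smul, Real.norm_eq_abs, Real.abs_exp, max_eq_left hs] at this
          simpa only [φ, max_eq_left hs] using this
        have h3 := norm_le_norm_add_norm_sub (f 0) (φ w s)
        rw [norm_sub_rev] at h3
        have h4 : 1 ≤ Real.exp (k * s) := Real.one_le_exp (by positivity)
        have h5 : K * (Real.exp (k * s) * ‖w s‖) ≤ K * (Real.exp (k * s) * ‖w‖) := by
          gcongr
          exact w.norm_coe_le_norm s
        nlinarith [norm_nonneg (f 0)]
    have h6 : ‖u w (max t 0)‖ ≤ ‖x₀‖ + (‖f 0‖ + K * ‖w‖) / k * Real.exp (k * max t 0) :=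
      (norm_add_le _ _).trans (by linarith)
    rw [norm_smul, Real.norm_eq_abs, Real.abs_exp]
    calc _ ≤ Real.exp (-(k * max t 0)) *
          (‖x₀‖ + (‖f 0‖ + K * ‖w‖) / k * Real.exp (k * max t 0)) := by gcongr
      _ = Real.exp (-(k * max t 0)) * ‖x₀‖ + (‖f 0‖ + K * ‖w‖) / k := by
          rw [Real.exp_neg]
          field_simp
      _ ≤ 1 * ‖x₀‖ + (‖f 0‖ + K * ‖w‖) / k := by
          gcongr
          exact Real.exp_le_one_iff.2 (by have := mul_nonneg hk.le h0; linarith)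
      _ = _ := by rw [one_mul]
  let Φ : BoundedContinuousFunction ℝ E → BoundedContinuousFunction ℝ E := fun w =>
    BoundedContinuousFunction.ofNormedAddCommGroup _ (hΦc w) _ (hΦb w)
  have hΦ : ContractingWith (K / (K + 1)) Φ := by
    refine ⟨(div_lt_one (by positivity)).2 (lt_add_one K), LipschitzWith.of_dist_le_mul
      fun w w' => (BoundedContinuousFunction.dist_le (by positivity)).2 fun t => ?_⟩
    have h0 : 0 ≤ max t 0 := le_max_right _ _
    have h1 := norm_integral_le_of_norm_le_mul_exp (g := fun s => φ w s - φ w' s)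
      (C := K * dist w w') hk (by positivity) h0 fun s hs => by
        have := hf.norm_sub_le (Real.exp (k * max s 0) • w s) (Real.exp (k * max s 0) • w' s)
        rw [← smul_sub, norm_smul, Real.norm_eq_abs, Real.abs_exp, max_eq_left hs,
          ← dist_eq_norm (w s)] at this
        calc _ ≤ K * (Real.exp (k * s) * dist (w s) (w' s)) := by
              simpa only [φ, max_eq_left hs] using this
          _ ≤ K * (Real.exp (k * s) * dist w w') := by
              gcongr
              exact w.dist_coe_le_dist s
          _ = _ := by ring
    have h2 : u w (max t 0) - u w' (max t 0) = ∫ s in (0 : ℝ)..max t 0, (φ w s - φ w' s) := by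
      rw [intervalIntegral.integral_sub ((hφ w).intervalIntegrable _ _)
        ((hφ w').intervalIntegrable _ _)]
      simp [u]
    change dist (Real.exp (-(k * max t 0)) • u w (max t 0))
      (Real.exp (-(k * max t 0)) • u w' (max t 0)) ≤ _
    rw [dist_eq_norm, ← smul_sub, norm_smul, Real.norm_eq_abs, Real.abs_exp, h2]
    calc _ ≤ Real.exp (-(k * max t 0)) * (K * dist w w' / k * Real.exp (k * max t 0)) := by gcongr
      _ = K / (K + 1) * dist w w' := by
          rw [Real.exp_neg]
          simp only [k]
          field_simp
      _ = _ := by push_cast; rfl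
  let w := hΦ.fixedPoint Φ
  have hw : Φ w = w := hΦ.fixedPoint_isFixedPt
  refine ⟨u w, by simp [u], fun t ht => ?_⟩
  have h1 : w t = Real.exp (-(k * t)) • u w t := by
    have := DFunLike.congr_fun hw t
    rw [← this]
    change Real.exp (-(k * max t 0)) • u w (max t 0) = _
    rw [max_eq_left ht]
  have h2 : φ w t = f (u w t) := by
    simp only [φ, max_eq_left ht, h1, smul_smul, ← Real.exp_add, add_neg_cancel, Real.exp_zero,
      one_smul]
  exact h2 ▸ hu w t

end GlobalFlow

/-! ### Asymptotics of the autonomous flow of a nonexpansive map -/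

section Autonomous

variable {H : Type*} [NormedAddCommGroup H] [InnerProductSpace ℝ H] {T : H → H} {u v y : ℝ → H}

theorem LipschitzWith.antitoneOn_norm_sub_of_hasDerivAt (hT : LipschitzWith 1 T)
    (hu : ∀ t, 0 ≤ t → HasDerivAt u (T (u t) - u t) t)
    (hv : ∀ t, 0 ≤ t → HasDerivAt v (T (v t) - v t) t) :
    AntitoneOn (fun t => ‖u t - v t‖) (Ici 0) := by
  have hd : ∀ t, 0 ≤ t → HasDerivAt (fun t => ‖u t - v t‖ ^ 2)
      (2 * inner ℝ (u t - v t) ((T (u t) - u t) - (T (v t) - v t))) t := fun t ht =>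
    ((hu t ht).sub (hv t ht)).norm_sq
  have hanti : AntitoneOn (fun t => ‖u t - v t‖ ^ 2) (Ici 0) := by
    refine antitoneOn_of_hasDerivWithinAt_nonpos (convex_Ici 0)
      (fun t ht => (hd t ht).continuousAt.continuousWithinAt)
      (fun t ht => (hd t (interior_subset ht)).hasDerivWithinAt) fun t _ => ?_
    linarith [hT.inner_sub_nonpos (u t) (v t)]
  exact fun s hs t ht hst => le_of_sq_le_sq (hanti hs ht hst) (norm_nonneg _)

/-- The speed is nonincreasing: it is the limit of the difference quotients
`‖y (t + h) - y t‖ / h`, and `y (· + h)` is another trajectory. -/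
theorem LipschitzWith.antitoneOn_norm_displacement (hT : LipschitzWith 1 T)
    (hy : ∀ t, 0 ≤ t → HasDerivAt y (T (y t) - y t) t) :
    AntitoneOn (fun t => ‖T (y t) - y t‖) (Ici 0) := by
  have hslope : ∀ t, 0 ≤ t → Tendsto (fun h : ℝ => ‖h⁻¹ • (y (t + h) - y t)‖) (𝓝[>] 0)
      (𝓝 ‖T (y t) - y t‖) := fun t ht =>
    ((hasDerivAt_iff_tendsto_slope_zero.1 (hy t ht)).mono_left
      (nhdsWithin_mono _ fun h (hh : 0 < h) => hh.ne')).norm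
  intro s hs t ht hst
  refine le_of_tendsto_of_tendsto (hslope t ht) (hslope s hs) ?_
  filter_upwards [self_mem_nhdsWithin] with h hh
  have hh : 0 < h := hh
  have hshift : ∀ r, 0 ≤ r → HasDerivAt (fun r => y (r + h)) (T (y (r + h)) - y (r + h)) r :=
    fun r hr => (hy (r + h) (by linarith)).comp_add_const r h
  have := hT.antitoneOn_norm_sub_of_hasDerivAt hshift hy hs ht hst
  rw [norm_smul, norm_smul]
  gcongr

/-- The speed decays like `t ^ (-1/2)`, because `t ↦ ‖y t - z‖ ^ 2` decreases at a rate at least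
the square of the speed, and the speed is nonincreasing. -/
theorem LipschitzWith.mul_norm_displacement_sq_le (hT : LipschitzWith 1 T)
    (hy : ∀ t, 0 ≤ t → HasDerivAt y (T (y t) - y t) t) {z : H} (hz : T z = z) {t : ℝ}
    (ht : 0 ≤ t) : t * ‖T (y t) - y t‖ ^ 2 ≤ ‖y 0 - z‖ ^ 2 := by
  have hd : ∀ s, 0 ≤ s → HasDerivAt (fun s => ‖y s - z‖ ^ 2 + s * ‖T (y t) - y t‖ ^ 2)
      (2 * inner ℝ (y s - z) (T (y s) - y s) + 1 * ‖T (y t) - y t‖ ^ 2) s := fun s hs =>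
    (((hy s hs).sub_const z).norm_sq).add ((hasDerivAt_id s).mul_const _)
  have hanti : AntitoneOn (fun s => ‖y s - z‖ ^ 2 + s * ‖T (y t) - y t‖ ^ 2) (Icc 0 t) := by
    refine antitoneOn_of_hasDerivWithinAt_nonpos (convex_Icc 0 t)
      (fun s hs => (hd s hs.1).continuousAt.continuousWithinAt)
      (fun s hs => (hd s (interior_subset hs).1).hasDerivWithinAt) fun s hs => ?_
    have hs := interior_subset hs
    have h1 := hT.antitoneOn_norm_displacement hy hs.1 ht hs.2
    have h2 := pow_le_pow_left₀ (norm_nonneg _) h1 2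
    have h3 := hT.two_mul_inner_sub_le hz (y s)
    linarith
  have := hanti (left_mem_Icc.2 ht) (right_mem_Icc.2 ht) ht
  simp only [zero_mul, add_zero] at this
  linarith [sq_nonneg ‖y t - z‖]

theorem LipschitzWith.tendsto_displacement (hT : LipschitzWith 1 T)
    (hy : ∀ t, 0 ≤ t → HasDerivAt y (T (y t) - y t) t) {z : H} (hz : T z = z) :
    Tendsto (fun t => T (y t) - y t) atTop (𝓝 0) := by
  rw [tendsto_zero_iff_norm_tendsto_zero]
  have h : Tendsto (fun t => ‖T (y t) - y t‖ ^ 2) atTop (𝓝 0) := by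
    refine squeeze_zero' (Eventually.of_forall fun t => sq_nonneg _) ?_
      (tendsto_const_nhds (x := ‖y 0 - z‖ ^ 2) |>.div_atTop tendsto_id)
    filter_upwards [eventually_gt_atTop 0] with t ht
    rw [id, le_div_iff₀ ht, mul_comm]
    exact hT.mul_norm_displacement_sq_le hy hz ht.le
  simpa using h.sqrt

theorem LipschitzWith.antitoneOn_norm_sub_fixedPoint (hT : LipschitzWith 1 T)
    (hy : ∀ t, 0 ≤ t → HasDerivAt y (T (y t) - y t) t) {z : H} (hz : T z = z) :
    AntitoneOn (fun t => ‖y t - z‖) (Ici 0) :=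
  hT.antitoneOn_norm_sub_of_hasDerivAt hy (v := fun _ => z) fun t _ => by
    simpa [hz] using hasDerivAt_const t z

theorem LipschitzWith.exists_fixedPoint_tendsto_inner [CompleteSpace H] (hT : LipschitzWith 1 T)
    (hy : ∀ t, 0 ≤ t → HasDerivAt y (T (y t) - y t) t) (hfix : ∃ z, T z = z) :
    ∃ p, T p = p ∧ ∀ v, Tendsto (fun t => inner ℝ (y t) v) atTop (𝓝 (inner ℝ p v)) := by
  obtain ⟨z, hz⟩ := hfix
  have hbdd : ∀ᶠ t in atTop, ‖y t‖ ≤ ‖y 0 - z‖ + ‖z‖ := by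
    filter_upwards [eventually_ge_atTop 0] with t ht
    have h1 := hT.antitoneOn_norm_sub_fixedPoint hy hz (mem_Ici.2 le_rfl) ht ht
    have h2 := norm_add_le (y t - z) z
    rw [sub_add_cancel] at h2
    exact h2.trans (by gcongr)
  refine exists_tendsto_inner_of_forall_tendsto_norm_sub (F := {p | T p = p}) ⟨z, hz⟩
    (fun q hq => ?_) fun U p hU hp => ?_
  · have hanti := hT.antitoneOn_norm_sub_fixedPoint hy hq
    have hanti' : Antitone fun t => ‖y (max t 0) - q‖ := fun s t hst =>
      hanti (mem_Ici.2 (le_max_right _ _)) (mem_Ici.2 (le_max_right _ _)) (max_le_max_right 0 hst)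
    refine ⟨_, (tendsto_atTop_ciInf hanti' ⟨0, ?_⟩).congr' ?_⟩
    · rintro _ ⟨t, rfl⟩
      exact norm_nonneg _
    · filter_upwards [eventually_ge_atTop 0] with t ht
      rw [max_eq_left ht]
  · exact hT.eq_of_tendsto_inner_of_tendsto_sub (hU hbdd) hp
      ((hT.tendsto_displacement hy hz).mono_left hU)

end Autonomous

/-! ### Absolutely continuous functions and uniqueness -/

theorem AbsolutelyContinuousOnInterval.of_dist_le {X Y : Type*} [PseudoMetricSpace X]
    [PseudoMetricSpace Y] {f : ℝ → X} {g : ℝ → Y} {a b : ℝ}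
    (hf : AbsolutelyContinuousOnInterval f a b)
    (h : ∀ s t, dist (g s) (g t) ≤ dist (f s) (f t)) : AbsolutelyContinuousOnInterval g a b :=
  squeeze_zero (fun _ => Finset.sum_nonneg fun _ _ => dist_nonneg)
    (fun _ => Finset.sum_le_sum fun _ _ => h _ _) hf

theorem AbsolutelyContinuousOnInterval.norm_sub_sq {E : Type*} [NormedAddCommGroup E]
    [NormedSpace ℝ E] {x y : ℝ → E} {a b : ℝ} (hx : AbsolutelyContinuousOnInterval x a b)
    (hy : AbsolutelyContinuousOnInterval y a b) :
    AbsolutelyContinuousOnInterval (fun t => ‖x t - y t‖ ^ 2) a b := by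
  have h : AbsolutelyContinuousOnInterval (fun t => ‖x t - y t‖) a b :=
    (hx.sub hy).of_dist_le fun s t => by
      simpa [Real.dist_eq, dist_eq_norm] using abs_norm_sub_norm_le (x s - y s) (x t - y t)
  simpa only [sq] using h.fun_mul h

namespace MonOp

variable {H : Type*} [NormedAddCommGroup H] [InnerProductSpace ℝ H] {T : H → H} {lam : ℝ → ℝ}
  {x₀ : H} {x : ℝ → H}

/-- Uniqueness: `‖x - y‖ ^ 2` is absolutely continuous, and its derivative is nonpositive almost
everywhere because `Id - T` is monotone. -/
theorem IsStrongGlobalSolution.eqOn (hT : LipschitzWith 1 T) (hlam : ∀ t, 0 ≤ t → 0 ≤ lam t)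
    {y : ℝ → H} (hx : IsStrongGlobalSolution T lam x₀ x)
    (hy : IsStrongGlobalSolution T lam x₀ y) : EqOn x y (Ici 0) := by
  intro b hb
  rcases (mem_Ici.1 hb).eq_or_lt with rfl | hb
  · rw [hx.init, hy.init]
  have hac := (hx.locallyAC b hb).norm_sub_sq (hy.locallyAC b hb)
  have hder : ∀ᵐ t, t ∈ Ioc 0 b → deriv (fun t => ‖x t - y t‖ ^ 2) t ≤ 0 := by
    filter_upwards [(ae_restrict_iff' measurableSet_Ici).1 hx.eqn,
      (ae_restrict_iff' measurableSet_Ici).1 hy.eqn] with t h1 h2 ht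
    have hd : deriv (fun t => ‖x t - y t‖ ^ 2) t =
        2 * inner ℝ (x t - y t) (lam t • (T (x t) - x t) - lam t • (T (y t) - y t)) :=
      ((h1 ht.1.le).sub (h2 ht.1.le)).norm_sq.deriv
    rw [hd, ← smul_sub, real_inner_smul_right]
    have := mul_nonpos_of_nonneg_of_nonpos (hlam t ht.1.le) (hT.inner_sub_nonpos (x t) (y t))
    linarith
  have hint : ∫ t in (0 : ℝ)..b, deriv (fun t => ‖x t - y t‖ ^ 2) t ≤ 0 := by
    rw [intervalIntegral.integral_of_le hb.le]
    exact integral_nonpos_of_ae ((ae_restrict_iff' measurableSet_Ioc).2 hder)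
  rw [hac.integral_deriv_eq_sub, hx.init, hy.init, sub_self, norm_zero] at hint
  have h0 : ‖x b - y b‖ = 0 := pow_eq_zero_iff two_ne_zero |>.1
    (le_antisymm (by linarith) (sq_nonneg _))
  exact sub_eq_zero.1 (norm_eq_zero.1 h0)

end MonOp

/-! ### The change of time -/

/-- The change of time `t ↦ ∫₀ᵗ lam`, with `lam` replaced by `0` at negative times. -/
noncomputable def timeChange (lam : ℝ → ℝ) (t : ℝ) : ℝ :=
  ∫ s in (0 : ℝ)..t, (Ici (0 : ℝ)).indicator lam s

section TimeChange

variable {lam : ℝ → ℝ} {δ : ℝ}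

@[simp]
theorem timeChange_zero : timeChange lam 0 = 0 := intervalIntegral.integral_same

theorem locallyIntegrable_indicator_Ici
    (hmeas : AEMeasurable lam (volume.restrict (Ici (0 : ℝ))))
    (hrange : ∀ t, 0 ≤ t → lam t ∈ Icc 0 δ) :
    LocallyIntegrable ((Ici (0 : ℝ)).indicator lam) volume := by
  refine MemLp.locallyIntegrable (p := ⊤) (memLp_top_of_bound
    ((aemeasurable_indicator_iff measurableSet_Ici).2 hmeas).aestronglyMeasurable δ
    (Eventually.of_forall fun t => ?_)) le_top
  have hδ : 0 ≤ δ := (hrange 0 le_rfl).1.trans (hrange 0 le_rfl).2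
  by_cases ht : t ∈ Ici (0 : ℝ)
  · rw [indicator_of_mem ht, Real.norm_eq_abs, abs_of_nonneg (hrange t ht).1]
    exact (hrange t ht).2
  · rwa [indicator_of_notMem ht, norm_zero]

theorem intervalIntegrable_indicator_Ici
    (hmeas : AEMeasurable lam (volume.restrict (Ici (0 : ℝ))))
    (hrange : ∀ t, 0 ≤ t → lam t ∈ Icc 0 δ) (a b : ℝ) :
    IntervalIntegrable ((Ici (0 : ℝ)).indicator lam) volume a b :=
  ((locallyIntegrable_indicator_Ici hmeas hrange).integrableOn_isCompact
    isCompact_uIcc).intervalIntegrable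

theorem timeChange_sub (hmeas : AEMeasurable lam (volume.restrict (Ici (0 : ℝ))))
    (hrange : ∀ t, 0 ≤ t → lam t ∈ Icc 0 δ) (s t : ℝ) :
    timeChange lam t - timeChange lam s = ∫ r in s..t, (Ici (0 : ℝ)).indicator lam r :=
  intervalIntegral.integral_interval_sub_left
    (intervalIntegrable_indicator_Ici hmeas hrange 0 t)
    (intervalIntegrable_indicator_Ici hmeas hrange 0 s)

theorem monotone_timeChange (hmeas : AEMeasurable lam (volume.restrict (Ici (0 : ℝ))))
    (hrange : ∀ t, 0 ≤ t → lam t ∈ Icc 0 δ) : Monotone (timeChange lam) := by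
  intro s t hst
  rw [← sub_nonneg, timeChange_sub hmeas hrange]
  exact intervalIntegral.integral_nonneg hst fun r _ =>
    indicator_nonneg (fun r hr => (hrange r hr).1) r

theorem timeChange_nonneg (hmeas : AEMeasurable lam (volume.restrict (Ici (0 : ℝ))))
    (hrange : ∀ t, 0 ≤ t → lam t ∈ Icc 0 δ) {t : ℝ} (ht : 0 ≤ t) : 0 ≤ timeChange lam t := by
  simpa using monotone_timeChange hmeas hrange ht

theorem lipschitzWith_timeChange (hmeas : AEMeasurable lam (volume.restrict (Ici (0 : ℝ))))
    (hrange : ∀ t, 0 ≤ t → lam t ∈ Icc 0 δ) : LipschitzWith δ.toNNReal (timeChange lam) := by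
  have hδ : 0 ≤ δ := (hrange 0 le_rfl).1.trans (hrange 0 le_rfl).2
  refine LipschitzWith.of_dist_le_mul fun t s => ?_
  rw [dist_eq_norm, timeChange_sub hmeas hrange, Real.dist_eq, Real.coe_toNNReal _ hδ]
  refine intervalIntegral.norm_integral_le_of_norm_le_const fun r _ => ?_
  by_cases hr : r ∈ Ici (0 : ℝ)
  · rw [indicator_of_mem hr, Real.norm_eq_abs, abs_of_nonneg (hrange r hr).1]
    exact (hrange r hr).2
  · rwa [indicator_of_notMem hr, norm_zero]

theorem ae_hasDerivAt_timeChange (hmeas : AEMeasurable lam (volume.restrict (Ici (0 : ℝ))))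
    (hrange : ∀ t, 0 ≤ t → lam t ∈ Icc 0 δ) :
    ∀ᵐ t ∂(volume.restrict (Ici (0 : ℝ))), HasDerivAt (timeChange lam) (lam t) t := by
  rw [ae_restrict_iff' measurableSet_Ici]
  filter_upwards [LocallyIntegrable.ae_hasDerivAt_integral
    (locallyIntegrable_indicator_Ici hmeas hrange)] with t h ht
  have := h 0
  rwa [indicator_of_mem ht] at this

theorem tendsto_timeChange_atTop (hmeas : AEMeasurable lam (volume.restrict (Ici (0 : ℝ))))
    (hrange : ∀ t, 0 ≤ t → lam t ∈ Icc 0 δ) (hlam : ¬ IntegrableOn lam (Ici 0)) :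
    Tendsto (timeChange lam) atTop atTop := by
  refine (monotone_timeChange hmeas hrange).tendsto_atTop_atTop fun c => ?_
  by_contra! hc
  refine hlam ?_
  have h : IntegrableOn ((Ici (0 : ℝ)).indicator lam) (Ioi 0) := by
    refine integrableOn_Ioi_of_intervalIntegral_norm_bounded c 0 (l := atTop) (b := id)
      (fun b => ((locallyIntegrable_indicator_Ici hmeas hrange).integrableOn_isCompact
        isCompact_Icc).mono_set Ioc_subset_Icc_self)
      tendsto_id (Eventually.of_forall fun b => ?_)
    refine le_of_eq_of_le ?_ (hc b).le
    refine intervalIntegral.integral_congr fun r _ => ?_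
    exact Real.norm_of_nonneg (indicator_nonneg (fun r hr => (hrange r hr).1) r)
  rw [integrableOn_Ici_iff_integrableOn_Ioi]
  exact h.congr_fun (fun t ht => indicator_of_mem (Ioi_subset_Ici_self ht) _) measurableSet_Ioi

theorem not_integrableOn_of_lintegral_mul_eq_top
    (hrange : ∀ t, 0 ≤ t → lam t ∈ Icc 0 δ)
    (hlam : (∫⁻ t in Ici (0 : ℝ), ENNReal.ofReal (lam t * (δ - lam t))) = ⊤ ∨
      0 < sInf (lam '' Ici (0 : ℝ))) : ¬ IntegrableOn lam (Ici 0) := by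
  intro hint
  rcases hlam with h | h
  · refine (lt_of_le_of_lt ?_ (hint.mul_const δ).lintegral_lt_top).ne h
    refine setLIntegral_mono' measurableSet_Ici fun t ht => ENNReal.ofReal_le_ofReal ?_
    exact mul_le_mul_of_nonneg_left (by linarith [(hrange t ht).1]) (hrange t ht).1
  · have hbdd : BddBelow (lam '' Ici (0 : ℝ)) := by
      refine ⟨0, ?_⟩
      rintro _ ⟨t, ht, rfl⟩
      exact (hrange t ht).1
    have hc : IntegrableOn (fun _ : ℝ => sInf (lam '' Ici (0 : ℝ))) (Ici 0) := by
      refine Integrable.mono' hint aestronglyMeasurable_const ?_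
      filter_upwards [ae_restrict_mem measurableSet_Ici] with t ht
      rw [Real.norm_of_nonneg h.le]
      exact csInf_le hbdd (mem_image_of_mem _ ht)
    rw [integrableOn_const_iff] at hc
    simp [h.ne'] at hc

end TimeChange

/-! ### The system with a time-dependent coefficient -/

section Speed

variable {H : Type*} [NormedAddCommGroup H] [InnerProductSpace ℝ H] {T : H → H} {y : ℝ → H}

theorem LipschitzWith.lipschitzOnWith_trajectory (hT : LipschitzWith 1 T)
    (hy : ∀ t, 0 ≤ t → HasDerivAt y (T (y t) - y t) t) {a : ℝ} (ha : 0 ≤ a) :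
    LipschitzOnWith ‖T (y a) - y a‖₊ y (Ici a) :=
  (convex_Ici a).lipschitzOnWith_of_nnnorm_hasDerivWithin_le
    (fun t ht => (hy t (ha.trans ht)).hasDerivWithinAt)
    fun _ ht => hT.antitoneOn_norm_displacement hy ha (ha.trans ht) ht

end Speed

namespace MonOp

variable {H : Type*} [NormedAddCommGroup H] [InnerProductSpace ℝ H] {T : H → H} {lam : ℝ → ℝ}
  {δ : ℝ} {x₀ : H} {x y : ℝ → H}

theorem lipschitzOnWith_comp_timeChange (hT : LipschitzWith 1 T)
    (hmeas : AEMeasurable lam (volume.restrict (Ici (0 : ℝ))))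
    (hrange : ∀ t, 0 ≤ t → lam t ∈ Icc 0 δ)
    (hy : ∀ t, 0 ≤ t → HasDerivAt y (T (y t) - y t) t) {a : ℝ} (ha : 0 ≤ a) :
    LipschitzOnWith (‖T (y (timeChange lam a)) - y (timeChange lam a)‖₊ * δ.toNNReal)
      (y ∘ timeChange lam) (Ici a) :=
  (hT.lipschitzOnWith_trajectory hy (timeChange_nonneg hmeas hrange ha)).comp
    (lipschitzWith_timeChange hmeas hrange).lipschitzOnWith
    fun _ ht => monotone_timeChange hmeas hrange ht

theorem isStrongGlobalSolution_comp_timeChange (hT : LipschitzWith 1 T)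
    (hmeas : AEMeasurable lam (volume.restrict (Ici (0 : ℝ))))
    (hrange : ∀ t, 0 ≤ t → lam t ∈ Icc 0 δ) (hy0 : y 0 = x₀)
    (hy : ∀ t, 0 ≤ t → HasDerivAt y (T (y t) - y t) t) :
    IsStrongGlobalSolution T lam x₀ (y ∘ timeChange lam) where
  locallyAC b hb := by
    refine LipschitzOnWith.absolutelyContinuousOnInterval
      ((lipschitzOnWith_comp_timeChange hT hmeas hrange hy le_rfl).mono ?_)
    rw [uIcc_of_le hb.le]
    exact Icc_subset_Ici_self
  eqn := by
    filter_upwards [ae_hasDerivAt_timeChange hmeas hrange, ae_restrict_mem measurableSet_Ici]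
      with t h1 ht
    exact (hy _ (timeChange_nonneg hmeas hrange ht)).scomp t h1
  init := by simp [hy0]

theorem exists_isStrongGlobalSolution [CompleteSpace H] (hT : LipschitzWith 1 T)
    (hmeas : AEMeasurable lam (volume.restrict (Ici (0 : ℝ))))
    (hrange : ∀ t, 0 ≤ t → lam t ∈ Icc 0 δ) (x₀ : H) :
    ∃ y : ℝ → H, (∀ t, 0 ≤ t → HasDerivAt y (T (y t) - y t) t) ∧
      IsStrongGlobalSolution T lam x₀ (y ∘ timeChange lam) := by
  obtain ⟨y, hy0, hy⟩ := (hT.sub LipschitzWith.id).exists_forall_hasDerivAt x₀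
  exact ⟨y, hy, isStrongGlobalSolution_comp_timeChange hT hmeas hrange hy0 hy⟩

/-- Every strong global solution is a trajectory of the autonomous system, run through at the
speed `lam`. -/
theorem IsStrongGlobalSolution.exists_eqOn_comp_timeChange [CompleteSpace H]
    (hT : LipschitzWith 1 T) (hmeas : AEMeasurable lam (volume.restrict (Ici (0 : ℝ))))
    (hrange : ∀ t, 0 ≤ t → lam t ∈ Icc 0 δ) (hx : IsStrongGlobalSolution T lam x₀ x) :
    ∃ y : ℝ → H, (∀ t, 0 ≤ t → HasDerivAt y (T (y t) - y t) t) ∧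
      EqOn x (y ∘ timeChange lam) (Ici 0) := by
  obtain ⟨y, hy, hsol⟩ := exists_isStrongGlobalSolution hT hmeas hrange x₀
  exact ⟨y, hy, hx.eqOn hT (fun t ht => (hrange t ht).1) hsol⟩

theorem IsStrongGlobalSolution.tendsto_displacement [CompleteSpace H]
    (hT : LipschitzWith 1 T) (hmeas : AEMeasurable lam (volume.restrict (Ici (0 : ℝ))))
    (hrange : ∀ t, 0 ≤ t → lam t ∈ Icc 0 δ) (hlam : ¬ IntegrableOn lam (Ici 0))
    (hx : IsStrongGlobalSolution T lam x₀ x) {z : H} (hz : T z = z) :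
    Tendsto (fun t => T (x t) - x t) atTop (𝓝 0) := by
  obtain ⟨y, hy, hxy⟩ := hx.exists_eqOn_comp_timeChange hT hmeas hrange
  refine ((hT.tendsto_displacement hy hz).comp
    (tendsto_timeChange_atTop hmeas hrange hlam)).congr' ?_
  filter_upwards [eventually_ge_atTop 0] with t ht
  rw [hxy ht]
  rfl

theorem IsStrongGlobalSolution.norm_sub_le [CompleteSpace H]
    (hT : LipschitzWith 1 T) (hmeas : AEMeasurable lam (volume.restrict (Ici (0 : ℝ))))
    (hrange : ∀ t, 0 ≤ t → lam t ∈ Icc 0 δ)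
    (hx : IsStrongGlobalSolution T lam x₀ x) {z : H} (hz : T z = z) {t : ℝ} (ht : 0 ≤ t) :
    ‖x t - z‖ ≤ ‖x₀ - z‖ := by
  obtain ⟨y, hy, hxy⟩ := hx.exists_eqOn_comp_timeChange hT hmeas hrange
  have h0 : x₀ = y 0 := by
    rw [← hx.init, hxy (mem_Ici.2 le_rfl), Function.comp_apply, timeChange_zero]
  rw [hxy ht, h0]
  have := timeChange_nonneg hmeas hrange ht
  exact hT.antitoneOn_norm_sub_fixedPoint hy hz (mem_Ici.2 le_rfl) this this

theorem IsStrongGlobalSolution.isBounded [CompleteSpace H]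
    (hT : LipschitzWith 1 T) (hmeas : AEMeasurable lam (volume.restrict (Ici (0 : ℝ))))
    (hrange : ∀ t, 0 ≤ t → lam t ∈ Icc 0 δ)
    (hx : IsStrongGlobalSolution T lam x₀ x) {z : H} (hz : T z = z) :
    Bornology.IsBounded (x '' Ici (0 : ℝ)) := by
  refine (Metric.isBounded_closedBall (x := z) (r := ‖x₀ - z‖)).subset ?_
  rintro _ ⟨t, ht, rfl⟩
  rw [mem_closedBall_iff_norm]
  exact hx.norm_sub_le hT hmeas hrange hz ht

/-- At every point of differentiability, exceptional or not for the equation, the derivative is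
controlled by a local Lipschitz constant, which tends to `0`. -/
theorem IsStrongGlobalSolution.tendsto_deriv [CompleteSpace H]
    (hT : LipschitzWith 1 T) (hmeas : AEMeasurable lam (volume.restrict (Ici (0 : ℝ))))
    (hrange : ∀ t, 0 ≤ t → lam t ∈ Icc 0 δ) (hlam : ¬ IntegrableOn lam (Ici 0))
    (hx : IsStrongGlobalSolution T lam x₀ x) {z : H} (hz : T z = z) :
    Tendsto (fun t => deriv x t) atTop (𝓝 0) := by
  have hdisp := hx.tendsto_displacement hT hmeas hrange hlam hz
  obtain ⟨y, hy, hxy⟩ := hx.exists_eqOn_comp_timeChange hT hmeas hrange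
  have hlim : Tendsto (fun t => ‖T (x (t - 1)) - x (t - 1)‖ * (δ.toNNReal : ℝ)) atTop (𝓝 0) := by
    have := (hdisp.comp (tendsto_atTop_add_const_right atTop (-1 : ℝ) tendsto_id)).norm.mul_const
      (δ.toNNReal : ℝ)
    simpa [sub_eq_add_neg] using this
  refine squeeze_zero_norm' ?_ hlim
  filter_upwards [eventually_ge_atTop 1] with t ht
  have ha : 0 ≤ t - 1 := by linarith
  have hLip := lipschitzOnWith_comp_timeChange hT hmeas hrange hy ha
  have hLip' : LipschitzOnWith (‖T (x (t - 1)) - x (t - 1)‖₊ * δ.toNNReal) x (Ici (t - 1)) := by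
    intro r hr s hs
    rw [hxy (mem_Ici.2 ha), hxy (mem_Ici.2 (ha.trans hr)), hxy (mem_Ici.2 (ha.trans hs))]
    exact hLip hr hs
  simpa using norm_deriv_le_of_lipschitzOn (Ici_mem_nhds (by linarith)) hLip'

theorem IsStrongGlobalSolution.continuousOn (hx : IsStrongGlobalSolution T lam x₀ x) {b : ℝ}
    (hb : 0 < b) : ContinuousOn x (Icc 0 b) := by
  have := (hx.locallyAC b hb).continuousOn
  rwa [uIcc_of_le hb.le] at this

/-- The energy estimate: `‖x'‖ ^ 2 ≤ -δ (‖x - z‖ ^ 2)'` for a fixed point `z`. -/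
theorem IsStrongGlobalSolution.integrableOn_norm_deriv_sq (hT : LipschitzWith 1 T)
    (hmeas : AEMeasurable lam (volume.restrict (Ici (0 : ℝ))))
    (hrange : ∀ t, 0 ≤ t → lam t ∈ Icc 0 δ)
    (hx : IsStrongGlobalSolution T lam x₀ x) {z : H} (hz : T z = z) :
    IntegrableOn (fun t => ‖deriv x t‖ ^ 2) (Ici (0 : ℝ)) := by
  have hδ : 0 ≤ δ := (hrange 0 le_rfl).1.trans (hrange 0 le_rfl).2
  let h : ℝ → ℝ := fun t => ‖x t - z‖ ^ 2
  have hac : ∀ b, 0 < b → AbsolutelyContinuousOnInterval h 0 b := fun b hb =>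
    (hx.locallyAC b hb).norm_sub_sq (y := fun _ => z)
      (LipschitzWith.const z).lipschitzOnWith.absolutelyContinuousOnInterval
  have hder : ∀ᵐ t, t ∈ Ici (0 : ℝ) → ‖deriv x t‖ ^ 2 = lam t ^ 2 * ‖T (x t) - x t‖ ^ 2 := by
    filter_upwards [(ae_restrict_iff' measurableSet_Ici).1 hx.eqn] with t h1 ht
    rw [(h1 ht).deriv, norm_smul, mul_pow, Real.norm_eq_abs, sq_abs]
  have hle : ∀ᵐ t, t ∈ Ici (0 : ℝ) → ‖deriv x t‖ ^ 2 ≤ -δ * deriv h t := by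
    filter_upwards [(ae_restrict_iff' measurableSet_Ici).1 hx.eqn, hder] with t h1 h2 ht
    have h3 : deriv h t = 2 * (lam t * inner ℝ (x t - z) (T (x t) - x t)) := by
      rw [← real_inner_smul_right]
      exact ((h1 ht).sub_const z).norm_sq.deriv
    rw [h2 ht, h3]
    have h4 := hT.two_mul_inner_sub_le hz (x t)
    have h5 := mul_le_mul_of_nonneg_left h4 (mul_nonneg hδ (hrange t ht).1)
    have h6 : lam t * lam t ≤ δ * lam t :=
      mul_le_mul_of_nonneg_right (hrange t ht).2 (hrange t ht).1
    nlinarith [mul_le_mul_of_nonneg_right h6 (sq_nonneg ‖T (x t) - x t‖)]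
  have hmeasd : ∀ b, 0 < b →
      AEStronglyMeasurable (fun t => ‖deriv x t‖ ^ 2) (volume.restrict (Ioc 0 b)) := by
    intro b hb
    have h1 : AEStronglyMeasurable lam (volume.restrict (Ioc 0 b)) :=
      (hmeas.mono_set (Ioc_subset_Icc_self.trans Icc_subset_Ici_self)).aestronglyMeasurable
    have h2 : ContinuousOn (fun t => ‖T (x t) - x t‖ ^ 2) (Ioc 0 b) := by
      have h3 := (hx.continuousOn hb).mono Ioc_subset_Icc_self
      exact ((hT.continuous.comp_continuousOn h3).sub h3).norm.pow 2
    refine ((h1.pow 2).mul (h2.aestronglyMeasurable measurableSet_Ioc)).congr ?_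
    rw [EventuallyEq, ae_restrict_iff' measurableSet_Ioc]
    filter_upwards [hder] with t h3 ht
    exact (h3 ht.1.le).symm
  have hint : ∀ b, 0 < b → IntegrableOn (fun t => ‖deriv x t‖ ^ 2) (Ioc 0 b) := by
    intro b hb
    have h1 : IntegrableOn (fun t => -δ * deriv h t) (Ioc 0 b) :=
      ((intervalIntegrable_iff_integrableOn_Ioc_of_le hb.le).1
        (hac b hb).intervalIntegrable_deriv).const_mul _
    refine Integrable.mono' h1 (hmeasd b hb) ?_
    rw [ae_restrict_iff' measurableSet_Ioc]
    filter_upwards [hle] with t h3 ht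
    rw [Real.norm_of_nonneg (sq_nonneg _)]
    exact h3 ht.1.le
  rw [integrableOn_Ici_iff_integrableOn_Ioi]
  refine integrableOn_Ioi_of_intervalIntegral_norm_bounded (δ * ‖x 0 - z‖ ^ 2) 0
    (b := fun b : ℝ => max b 1) (l := atTop) (fun b => hint _ (by positivity))
    (tendsto_atTop_mono (fun b => le_max_left b 1) tendsto_id) (Eventually.of_forall fun b => ?_)
  have hb : 0 < max b 1 := by positivity
  have h1 := (hac _ hb).integral_deriv_eq_sub
  have h2 : ∫ t in (0 : ℝ)..max b 1, ‖‖deriv x t‖ ^ 2‖ ≤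
      ∫ t in (0 : ℝ)..max b 1, -δ * deriv h t := by
    refine intervalIntegral.integral_mono_ae_restrict hb.le
      ((intervalIntegrable_iff_integrableOn_Ioc_of_le hb.le).2 (hint _ hb).norm)
      ((hac _ hb).intervalIntegrable_deriv.const_mul _) ?_
    rw [EventuallyLE, ae_restrict_iff' measurableSet_Icc]
    filter_upwards [hle] with t h3 ht
    rw [Real.norm_of_nonneg (sq_nonneg _)]
    exact h3 ht.1
  rw [intervalIntegral.integral_const_mul, h1] at h2
  have h3 : 0 ≤ δ * ‖x (max b 1) - z‖ ^ 2 := by positivity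
  simp only [h] at h2
  linarith

theorem IsStrongGlobalSolution.exists_tendsto_toWeakSpace [CompleteSpace H]
    (hT : LipschitzWith 1 T) (hmeas : AEMeasurable lam (volume.restrict (Ici (0 : ℝ))))
    (hrange : ∀ t, 0 ≤ t → lam t ∈ Icc 0 δ) (hlam : ¬ IntegrableOn lam (Ici 0))
    (hx : IsStrongGlobalSolution T lam x₀ x) (hfix : ∃ z, T z = z) :
    ∃ p, T p = p ∧ Tendsto (fun t => toWeakSpace ℝ H (x t)) atTop (𝓝 (toWeakSpace ℝ H p)) := by
  obtain ⟨y, hy, hxy⟩ := hx.exists_eqOn_comp_timeChange hT hmeas hrange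
  obtain ⟨p, hp, hlim⟩ := hT.exists_fixedPoint_tendsto_inner hy hfix
  refine ⟨p, hp, tendsto_toWeakSpace_of_tendsto_inner fun v => ?_⟩
  refine ((hlim v).comp (tendsto_timeChange_atTop hmeas hrange hlam)).congr' ?_
  filter_upwards [eventually_ge_atTop 0] with t ht
  rw [hxy ht]
  rfl

end MonOp

/-! ### The forward-backward mapping -/

namespace MonOp

theorem mem_zer_add_ofFun {E : Type*} [NormedAddCommGroup E] {A : E → Set E} {B : E → E}
    {z : E} : z ∈ zer (add A (ofFun B)) ↔ -B z ∈ A z := by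
  constructor
  · rintro ⟨u, hu, v, rfl, h⟩
    rwa [← eq_neg_of_add_eq_zero_left h.symm]
  · exact fun h => ⟨_, h, B z, rfl, by simp⟩

theorem tendsto_zero_of_modulus_le {E : Type*} [SeminormedAddCommGroup E] {φ : NNReal → ENNReal}
    (hφ : Monotone φ) (hφ0 : ∀ r, φ r = 0 ↔ r = 0) {ι : Type*} {l : Filter ι} {n : ι → E}
    {c : ι → ℝ}
    (hle : ∀ᶠ i in l, ((φ ‖n i‖₊ : ENNReal) : EReal) ≤ ((c i : ℝ) : EReal))
    (hc : Tendsto c l (𝓝 0)) : Tendsto n l (𝓝 0) := by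
  rw [Metric.tendsto_nhds]
  intro ε hε
  lift ε to NNReal using hε.le
  have hpos : 0 < φ ε := pos_iff_ne_zero.2 fun h => (NNReal.coe_pos.1 hε).ne' ((hφ0 ε).1 h)
  have hc' : Tendsto (fun i => ENNReal.ofReal (c i)) l (𝓝 0) := by
    simpa using ENNReal.tendsto_ofReal hc
  filter_upwards [hle, hc'.eventually_lt_const hpos] with i h1 h2
  have h3 : φ ‖n i‖₊ ≤ ENNReal.ofReal (c i) := by
    rw [← EReal.coe_ennreal_le_coe_ennreal_iff, EReal.coe_ennreal_ofReal]
    exact h1.trans (EReal.coe_le_coe_iff.2 (le_max_left _ _))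
  rw [dist_zero_right, ← coe_nnnorm, NNReal.coe_lt_coe]
  exact hφ.reflect_lt (h3.trans_lt h2)

variable {H : Type*} [NormedAddCommGroup H] [InnerProductSpace ℝ H] {A : H → Set H} {B : H → H}
  {β γ : ℝ}

theorem IsMaximallyMonotone.forwardBackward_mem [CompleteSpace H] (hA : IsMaximallyMonotone A)
    (hγ : 0 < γ) (B : H → H) (x : H) :
    γ⁻¹ • (x - forwardBackward γ A B x) - B x ∈ A (forwardBackward γ A B x) := by
  obtain ⟨_, ⟨u, hu, rfl⟩, h⟩ := hA.resolvent_mem hγ (x - γ • B x)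
  have h1 : x - forwardBackward γ A B x = γ • (u + B x) := by
    rw [smul_add, ← sub_eq_iff_eq_add, sub_right_comm, ← h]
    exact add_sub_cancel_left _ _
  rw [h1, inv_smul_smul₀ hγ.ne', add_sub_cancel_right]
  exact hu

theorem IsMaximallyMonotone.forwardBackward_eq_self_iff [CompleteSpace H]
    (hA : IsMaximallyMonotone A) (hγ : 0 < γ) {z : H} :
    forwardBackward γ A B z = z ↔ z ∈ zer (add A (ofFun B)) := by
  rw [mem_zer_add_ofFun]
  constructor
  · intro h
    have := hA.forwardBackward_mem hγ B z
    rwa [h, sub_self, smul_zero, zero_sub] at this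
  · intro h
    refine (hA.1.smul hγ.le).resolventSet_subsingleton (z - γ • B z) (hA.resolvent_mem hγ _)
      ⟨_, ⟨_, h, rfl⟩, ?_⟩
    rw [smul_neg, sub_eq_add_neg]

theorem IsMaximallyMonotone.lipschitzWith_resolvent [CompleteSpace H]
    (hA : IsMaximallyMonotone A) (hγ : 0 < γ) : LipschitzWith 1 (resolvent (smul γ A)) := by
  refine LipschitzWith.of_dist_le_mul fun a b => ?_
  obtain ⟨u, hu, hpu⟩ := hA.resolvent_mem hγ a
  obtain ⟨v, hv, hqv⟩ := hA.resolvent_mem hγ b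
  have h := hA.1.smul hγ.le _ _ _ _ hu hv
  rw [NNReal.coe_one, one_mul, dist_eq_norm, dist_eq_norm]
  set p := resolvent (smul γ A) a
  set q := resolvent (smul γ A) b
  have e : u - v = (a - b) - (p - q) := by
    rw [← hpu, ← hqv]
    abel
  rw [e, inner_sub_right, real_inner_self_eq_norm_sq] at h
  have h1 := real_inner_le_norm (p - q) (a - b)
  by_contra! hlt
  nlinarith [norm_nonneg (a - b)]

theorem IsCocoercive.lipschitzWith_sub_smul (hB : IsCocoercive β B) (hγ : 0 ≤ γ)
    (hγβ : γ ≤ 2 * β) : LipschitzWith 1 fun x => x - γ • B x := by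
  refine LipschitzWith.of_dist_le_mul fun a b => ?_
  rw [NNReal.coe_one, one_mul, dist_eq_norm, dist_eq_norm]
  have e : a - γ • B a - (b - γ • B b) = (a - b) - γ • (B a - B b) := by
    rw [smul_sub]
    abel
  refine le_of_sq_le_sq ?_ (norm_nonneg _)
  rw [e, norm_sub_sq_real, real_inner_smul_right, norm_smul, mul_pow, Real.norm_eq_abs, sq_abs]
  have h1 := mul_le_mul_of_nonneg_left (hB a b) hγ
  have h2 : γ * γ * ‖B a - B b‖ ^ 2 ≤ γ * (2 * β) * ‖B a - B b‖ ^ 2 := by gcongr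
  linarith

theorem IsMaximallyMonotone.lipschitzWith_forwardBackward [CompleteSpace H]
    (hA : IsMaximallyMonotone A) (hB : IsCocoercive β B) (hγ : 0 < γ) (hγβ : γ ≤ 2 * β) :
    LipschitzWith 1 (forwardBackward γ A B) := by
  have := (hA.lipschitzWith_resolvent hγ).comp (hB.lipschitzWith_sub_smul hγ.le hγβ)
  rwa [one_mul] at this

theorem IsCocoercive.norm_sub_le (hB : IsCocoercive β B) (hβ : 0 < β) (x y : H) :
    ‖B x - B y‖ ≤ β⁻¹ * ‖x - y‖ := by
  rw [inv_mul_eq_div, le_div_iff₀ hβ]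
  have h1 := (hB x y).trans (real_inner_le_norm _ _)
  by_contra! hlt
  nlinarith [norm_nonneg (x - y), norm_nonneg (B x - B y),
    mul_pos hβ (show 0 < ‖B x - B y‖ by nlinarith [norm_nonneg (x - y)])]

/-- `B` is constant on the zeros of `A + B`, since `⟪y - z, B y - B z⟫` is nonpositive there by
monotonicity of `A`. -/
theorem IsMonotone.apply_eq_of_mem_zer (hA : IsMonotone A) (hB : IsCocoercive β B) (hβ : 0 < β)
    {y z : H} (hy : y ∈ zer (add A (ofFun B))) (hz : z ∈ zer (add A (ofFun B))) : B y = B z := by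
  have h1 := hA _ _ _ _ (mem_zer_add_ofFun.1 hy) (mem_zer_add_ofFun.1 hz)
  rw [neg_sub_neg, ← neg_sub (B y), inner_neg_right] at h1
  have h2 := hB y z
  have h3 : ‖B y - B z‖ ^ 2 ≤ 0 := by
    by_contra! hlt
    nlinarith [mul_pos hβ hlt]
  exact sub_eq_zero.1 (norm_eq_zero.1 (pow_eq_zero_iff two_ne_zero |>.1
    (le_antisymm h3 (sq_nonneg _))))

/-- Along any bounded family on which the forward-backward residual vanishes, `B` converges to its
common value on the zeros of `A + B`. -/
theorem IsMaximallyMonotone.tendsto_apply_of_tendsto_displacement [CompleteSpace H]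
    (hA : IsMaximallyMonotone A) (hB : IsCocoercive β B) (hβ : 0 < β) (hγ : 0 < γ)
    (hγβ : γ ≤ 2 * β) {ι : Type*} {l : Filter ι} {x : ι → H} {z : H} {R : ℝ}
    (hz : z ∈ zer (add A (ofFun B))) (hbdd : ∀ᶠ i in l, ‖x i - z‖ ≤ R)
    (hx : Tendsto (fun i => forwardBackward γ A B (x i) - x i) l (𝓝 0)) :
    Tendsto (fun i => B (x i)) l (𝓝 (B z)) := by
  set T := forwardBackward γ A B with hTdef
  have hT : LipschitzWith 1 T := hA.lipschitzWith_forwardBackward hB hγ hγβ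
  have hTz : T z = z := (hA.forwardBackward_eq_self_iff hγ).2 hz
  have hlim : Tendsto (fun i => β⁻¹ * (‖T (x i) - x i‖ * ((γ⁻¹ + β⁻¹) * R))) l (𝓝 0) := by
    simpa using (hx.norm.mul_const ((γ⁻¹ + β⁻¹) * R)).const_mul β⁻¹
  have hsq : Tendsto (fun i => ‖B (x i) - B z‖ ^ 2) l (𝓝 0) := by
    refine squeeze_zero' (Eventually.of_forall fun i => sq_nonneg _) ?_ hlim
    filter_upwards [hbdd] with i hi
    rw [inv_mul_eq_div, le_div_iff₀ hβ]
    have h1 := hA.1 _ _ _ _ (hA.forwardBackward_mem hγ B (x i)) (mem_zer_add_ofFun.1 hz)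
    rw [← hTdef] at h1
    have h2 := hB (x i) z
    have h3 : ‖T (x i) - z‖ ≤ R := by
      have := hT.norm_sub_le (x i) z
      rw [hTz, NNReal.coe_one, one_mul] at this
      exact this.trans hi
    have h4 : ‖B (x i) - B z‖ ≤ β⁻¹ * R := (hB.norm_sub_le hβ _ _).trans (by gcongr)
    set b := B (x i) - B z with hb
    set p := T (x i)
    have e1 : γ⁻¹ • (x i - p) - B (x i) - -B z = γ⁻¹ • (x i - p) - b := by
      rw [hb]
      abel
    have e2 : inner ℝ (x i - z) b = inner ℝ (p - z) b - inner ℝ (p - x i) b := by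
      rw [← inner_sub_left, sub_sub_sub_cancel_left]
    rw [e1, inner_sub_right, real_inner_smul_right] at h1
    have h5 := real_inner_le_norm (p - z) (x i - p)
    have h6 := neg_le_of_abs_le (abs_real_inner_le_norm (p - x i) b)
    rw [norm_sub_rev (x i) p] at h5
    have h7 : γ⁻¹ * inner ℝ (p - z) (x i - p) ≤ γ⁻¹ * (R * ‖p - x i‖) := by
      gcongr
      exact h5.trans (by gcongr)
    have h8 : ‖p - x i‖ * ‖b‖ ≤ ‖p - x i‖ * (β⁻¹ * R) := by gcongr
    linarith
  have h0 : Tendsto (fun i => ‖B (x i) - B z‖) l (𝓝 0) := by simpa using hsq.sqrt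
  exact tendsto_iff_norm_sub_tendsto_zero.2 h0

/-- The modulus of `A` is evaluated at the forward-backward image of `x` and at `z`, that of `B` at
`x` and `z`; the inner products bounding it tend to `0` with the residual. -/
theorem IsMaximallyMonotone.tendsto_of_isUniformlyMonotone [CompleteSpace H]
    (hA : IsMaximallyMonotone A) (hB : IsCocoercive β B) (hβ : 0 < β) (hγ : 0 < γ)
    (hγβ : γ ≤ 2 * β) (hunif : IsUniformlyMonotone A ∨ IsUniformlyMonotone (ofFun B))
    {ι : Type*} {l : Filter ι} {x : ι → H} {z : H} {R : ℝ}
    (hz : z ∈ zer (add A (ofFun B))) (hbdd : ∀ᶠ i in l, ‖x i - z‖ ≤ R)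
    (hx : Tendsto (fun i => forwardBackward γ A B (x i) - x i) l (𝓝 0)) :
    Tendsto x l (𝓝 z) := by
  have hBx := hA.tendsto_apply_of_tendsto_displacement hB hβ hγ hγβ hz hbdd hx
  have hBx' : Tendsto (fun i => ‖B (x i) - B z‖) l (𝓝 0) :=
    tendsto_iff_norm_sub_tendsto_zero.1 hBx
  rw [← tendsto_sub_nhds_zero_iff]
  rcases hunif with ⟨φ, hφ, hφ0, h⟩ | ⟨φ, hφ, hφ0, h⟩
  · set T := forwardBackward γ A B with hTdef
    have hT : LipschitzWith 1 T := hA.lipschitzWith_forwardBackward hB hγ hγβ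
    have hTz : T z = z := (hA.forwardBackward_eq_self_iff hγ).2 hz
    have hlim : Tendsto (fun i => R * (γ⁻¹ * ‖T (x i) - x i‖ + ‖B (x i) - B z‖)) l (𝓝 0) := by
      simpa using ((hx.norm.const_mul γ⁻¹).add hBx').const_mul R
    have hTx : Tendsto (fun i => T (x i) - z) l (𝓝 0) := by
      refine tendsto_zero_of_modulus_le hφ hφ0 ?_ hlim
      filter_upwards [hbdd] with i hi
      refine (h _ _ _ _ (hA.forwardBackward_mem hγ B (x i)) (mem_zer_add_ofFun.1 hz)).trans
        (EReal.coe_le_coe_iff.2 ((real_inner_le_norm _ _).trans ?_))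
      have h3 : ‖T (x i) - z‖ ≤ R := by
        have := hT.norm_sub_le (x i) z
        rw [hTz, NNReal.coe_one, one_mul] at this
        exact this.trans hi
      refine mul_le_mul h3 ?_ (norm_nonneg _) ((norm_nonneg _).trans h3)
      have e : γ⁻¹ • (x i - T (x i)) - B (x i) - -B z =
          γ⁻¹ • (x i - T (x i)) - (B (x i) - B z) := by abel
      rw [e]
      refine (_root_.norm_sub_le _ _).trans ?_
      rw [norm_smul, Real.norm_of_nonneg (inv_nonneg.2 hγ.le), norm_sub_rev (x i)]
    simpa using hTx.sub hx
  · have hlim : Tendsto (fun i => R * ‖B (x i) - B z‖) l (𝓝 0) := by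
      simpa using hBx'.const_mul R
    refine tendsto_zero_of_modulus_le hφ hφ0 ?_ hlim
    filter_upwards [hbdd] with i hi
    refine (h _ _ _ _ rfl rfl).trans
      (EReal.coe_le_coe_iff.2 ((real_inner_le_norm _ _).trans ?_))
    gcongr

end MonOp

theorem theorem2p7 {H : Type*} [NormedAddCommGroup H] [InnerProductSpace ℝ H] [CompleteSpace H]
    (A : H → Set H) (hA : MonOp.IsMaximallyMonotone A)
    (β : ℝ) (hβ : 0 < β) (B : H → H) (hB : MonOp.IsCocoercive β B)
    (hzer : (MonOp.zer (MonOp.add A (MonOp.ofFun B))).Nonempty)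
    (γ : ℝ) (hγ : γ ∈ Set.Ioo 0 (2 * β))
    (δ : ℝ) (hδ : δ = (4 * β - γ) / (2 * β))
    (lam : ℝ → ℝ) (hlam_meas : AEMeasurable lam (volume.restrict (Set.Ici (0 : ℝ))))
    (hlam_range : ∀ t, 0 ≤ t → lam t ∈ Set.Icc 0 δ)
    (hlam : (∫⁻ t in Set.Ici (0 : ℝ), ENNReal.ofReal (lam t * (δ - lam t))) = ⊤ ∨
      0 < sInf (lam '' Set.Ici (0 : ℝ)))
    (x₀ : H) :
    -- the resolvent is everywhere defined and single-valued
    (∀ z, MonOp.resolventSet (MonOp.smul γ A) z = {MonOp.resolvent (MonOp.smul γ A) z}) ∧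
    -- existence and uniqueness of the strong global solution
    (∃ x, MonOp.IsStrongGlobalSolution (MonOp.forwardBackward γ A B) lam x₀ x) ∧
    (∀ x y, MonOp.IsStrongGlobalSolution (MonOp.forwardBackward γ A B) lam x₀ x →
      MonOp.IsStrongGlobalSolution (MonOp.forwardBackward γ A B) lam x₀ y →
      Set.EqOn x y (Set.Ici (0 : ℝ))) ∧
    ∀ x : ℝ → H, MonOp.IsStrongGlobalSolution (MonOp.forwardBackward γ A B) lam x₀ x →
      -- (i)
      (Bornology.IsBounded (x '' Set.Ici (0 : ℝ)) ∧
        IntegrableOn (fun t => ‖deriv x t‖ ^ 2) (Set.Ici (0 : ℝ))) ∧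
      -- (ii)
      Tendsto (fun t => MonOp.resolvent (MonOp.smul γ A) (x t - γ • B (x t)) - x t)
        atTop (𝓝 0) ∧
      -- (iii)
      Tendsto (fun t => deriv x t) atTop (𝓝 0) ∧
      -- (iv)
      (∃ y ∈ MonOp.zer (MonOp.add A (MonOp.ofFun B)),
        Tendsto (fun t => toWeakSpace ℝ H (x t)) atTop (𝓝 (toWeakSpace ℝ H y))) ∧
      (0 < sInf (lam '' Set.Ici (0 : ℝ)) →
        -- (v)
        ((∀ y ∈ MonOp.zer (MonOp.add A (MonOp.ofFun B)),
            Tendsto (fun t => B (x t)) atTop (𝓝 (B y))) ∧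
          (∀ y ∈ MonOp.zer (MonOp.add A (MonOp.ofFun B)),
            ∀ z ∈ MonOp.zer (MonOp.add A (MonOp.ofFun B)), B y = B z)) ∧
        -- (vi)
        ((MonOp.IsUniformlyMonotone A ∨ MonOp.IsUniformlyMonotone (MonOp.ofFun B)) →
          ∃ y, MonOp.zer (MonOp.add A (MonOp.ofFun B)) = {y} ∧
            Tendsto x atTop (𝓝 y))) := by
  have hγ0 : 0 < γ := hγ.1
  have hγβ : γ ≤ 2 * β := hγ.2.le
  have hT := hA.lipschitzWith_forwardBackward hB hγ0 hγβ
  have hfix := fun z => hA.forwardBackward_eq_self_iff (B := B) hγ0 (z := z)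
  have hint := not_integrableOn_of_lintegral_mul_eq_top hlam_range hlam
  obtain ⟨z, hz⟩ := hzer
  have hTz := (hfix z).2 hz
  refine ⟨hA.resolventSet_eq_singleton hγ0, ?_,
    fun x y hx hy => hx.eqOn hT (fun t ht => (hlam_range t ht).1) hy, fun x hx => ?_⟩
  · obtain ⟨y, -, hy⟩ := MonOp.exists_isStrongGlobalSolution hT hlam_meas hlam_range x₀
    exact ⟨_, hy⟩
  have hdisp := hx.tendsto_displacement hT hlam_meas hlam_range hint hTz
  have hbdd : ∀ y ∈ MonOp.zer (MonOp.add A (MonOp.ofFun B)),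
      ∀ᶠ t in atTop, ‖x t - y‖ ≤ ‖x₀ - y‖ := fun y hy => by
    filter_upwards [eventually_ge_atTop 0] with t ht
    exact hx.norm_sub_le hT hlam_meas hlam_range ((hfix y).2 hy) ht
  refine ⟨⟨hx.isBounded hT hlam_meas hlam_range hTz,
    hx.integrableOn_norm_deriv_sq hT hlam_meas hlam_range hTz⟩, hdisp,
    hx.tendsto_deriv hT hlam_meas hlam_range hint hTz, ?_, fun _ => ⟨⟨fun y hy => ?_,
      fun y hy w hw => hA.1.apply_eq_of_mem_zer hB hβ hy hw⟩, fun hunif => ?_⟩⟩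
  · obtain ⟨p, hp, hlim⟩ :=
      hx.exists_tendsto_toWeakSpace hT hlam_meas hlam_range hint ⟨z, hTz⟩
    exact ⟨p, (hfix p).1 hp, hlim⟩
  · exact hA.tendsto_apply_of_tendsto_displacement hB hβ hγ0 hγβ hy (hbdd y hy) hdisp
  · -- `x` converges to every zero, so there is only one
    have hlim : ∀ y ∈ MonOp.zer (MonOp.add A (MonOp.ofFun B)), Tendsto x atTop (𝓝 y) :=
      fun y hy =>
        hA.tendsto_of_isUniformlyMonotone hB hβ hγ0 hγβ hunif hy (hbdd y hy) hdisp
    exact ⟨z, eq_singleton_iff_unique_mem.2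
      ⟨hz, fun y hy => tendsto_nhds_unique (hlim y hy) (hlim z hz)⟩, hlim z hz⟩
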